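/- Let $n\ge 1$. An $n$-voter strong simple game is a family $S$ of subsets ("winning coalitions") of $\{1,\dots,n\}$ that is closed under passing to supersets and such that, for every $A\subseteq\{1,\dots,n\}$, exactly one of $A$ and its complement belongs to $S$. The dictatorship of voter $i$ is $\{A : i\in A\}$, and the median of three strong simple games is $$m(S,T,U)=(S\cap T)\cup(S\cap U)\cup(T\cap U),$$ which is again a strong simple game. A game has weight at most $0$ if it is a dictatorship, and weight at most $k+1$ if it is the median of three strong simple games (on the same voters) of weight at most $k$. The weight of $S$ is the least $k$ such that $S$ has weight at most $k$, and $W(n)$ is the largest weight of an $n$-voter strong simple game. For every $n\ge 1$ every $n$-voter strong simple game has a (finite) weight and the maximum $W(n)$ exists. Moreover: (1) $W(1)=0$, $W(2)=0$, $W(3)=1$, $W(4)=2$, $W(5)=3$, $W(6)=3$. (2) $W(n)\le n-3$ for all $n\ge 6$. (3) $W(n)$ is asymptotically at least $\frac{\ln 2}{\ln 3}\,n$: for every real $c<\frac{\ln 2}{\ln 3}$ one has $W(n)\ge c\,n$ for all sufficiently large $n$. More precisely, there is a constant $C$ such that $W(n)\ge \frac{\ln 2}{\ln 3}\,n-C\ln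 n$ for all $n\ge 2$. (4) For all $n\ge 1$, $W(n+1)=W(n)$ or $W(n+1)=W(n)+1$. -/

import Mathlib

/-- A strong simple game on a finite set `V` of voters: an upward closed family of winning
coalitions such that, of every coalition and its complement, exactly one wins. -/
@[ext]
structure StrongSimpleGame (V : Type*) [Fintype V] [DecidableEq V] where
  /-- the winning coalitions -/
  winning : Finset (Finset V)
  upward : ∀ A B : Finset V, A ∈ winning → A ⊆ B → B ∈ winning
  simple : ∀ A : Finset V, A ∈ winning → Aᶜ ∉ winning
  strong : ∀ A : Finset V, A ∉ winning → Aᶜ ∈ winning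

namespace StrongSimpleGame

variable {V : Type*} [Fintype V] [DecidableEq V]

/-- The dictatorship of the voter `v`: a coalition wins if and only if it contains `v`. -/
def dictatorship (v : V) : StrongSimpleGame V where
  winning := Finset.univ.filter (fun A => v ∈ A)
  upward A B hA hAB := by
    simp only [Finset.mem_filter, Finset.mem_univ, true_and] at hA ⊢
    exact hAB hA
  simple A hA := by simpa using hA
  strong A hA := by simpa using hA

/-- The median of three games: a coalition wins if and only if it wins in at least two of
the three games. -/
def median (S T U : StrongSimpleGame V) : StrongSimpleGame V where
  winning := (S.winning ∩ T.winning) ∪ (S.winning ∩ U.winning) ∪ (T.winning ∩ U.winning)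
  upward A B hA hAB := by
    have h1 := S.upward A B
    have h2 := T.upward A B
    have h3 := U.upward A B
    simp only [Finset.mem_union, Finset.mem_inter] at hA ⊢
    tauto
  simple A hA := by
    have h1 := S.simple A
    have h2 := T.simple A
    have h3 := U.simple A
    simp only [Finset.mem_union, Finset.mem_inter] at hA ⊢
    tauto
  strong A hA := by
    have h1 := S.strong A
    have h2 := T.strong A
    have h3 := U.strong A
    simp only [Finset.mem_union, Finset.mem_inter] at hA ⊢
    tauto

/-- `S.WeightAtMost k`: the game `S` is obtained from dictatorships by at most `k` iterations
of the median operation. That is, `S` is a dictatorship if `k = 0`, and `S` is the median of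
three strong simple games of weight at most `k - 1` if `0 < k`. -/
def WeightAtMost : ℕ → StrongSimpleGame V → Prop
  | 0, S => ∃ v : V, S = dictatorship v
  | k + 1, S => ∃ T₁ T₂ T₃ : StrongSimpleGame V,
      WeightAtMost k T₁ ∧ WeightAtMost k T₂ ∧ WeightAtMost k T₃ ∧ S = median T₁ T₂ T₃

theorem median_self (S : StrongSimpleGame V) : median S S S = S := by
  ext A
  simp [median]

/-- The bound in `WeightAtMost` may be increased, because `S` is the median of `S, S, S`. -/
theorem WeightAtMost.mono {k l : ℕ} (hkl : k ≤ l) {S : StrongSimpleGame V}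
    (h : WeightAtMost k S) : WeightAtMost l S := by
  induction hkl with
  | refl => exact h
  | step _ ih => exact ⟨S, S, S, ih, ih, ih, (median_self S).symm⟩

/-- The weight of a strong simple game: the least number of iterations of the median operation
which generates it from dictatorships. -/
noncomputable def weight (S : StrongSimpleGame V) : ℕ :=
  sInf {k : ℕ | WeightAtMost k S}

end StrongSimpleGame

/-- The largest weight of a strong simple game with `n` voters. -/
noncomputable def maxWeight (n : ℕ) : ℕ :=
  sSup (Set.range (StrongSimpleGame.weight : StrongSimpleGame (Fin n) → ℕ))

/-!
Merging voters drives the upper bounds. For voters `a`, `b`, `c` of a game `S`, let `a` copy `b`,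
`b` copy `c`, or `c` copy `a`; the game `S` is the median of the three resulting games
(`eq_median_map_update`), and each of them is a game with one voter less, because a voter who
copies another one has no influence of their own. So one more voter costs at most one more median
(`weightAtMost_succ_of_forall`). A game on `n` voters is also a game on `n + 1` voters, with one
dummy voter, of the same weight, so `maxWeight` grows by `0` or `1` in each step.

Starting from `n = 2`, this gives the upper bounds `1`, `2`, `3` for `n = 3`, `4`, `5`. For
`n = 6` a step is saved. The majority game is the only game on five voters of weight three
(`weightAtMost_two_of_ne_majorityFive`, `not_weightAtMost_two_majorityFive`), and it does not arise
by merging two voters of a winning coalition `{a, b, c}`, since afterwards two voters win. The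
lower bounds for `n = 3`, `4` follow from the one for `n = 5`, again because the steps are at most
`1`.

The asymptotic lower bound is a count. There are at most `n ^ 3 ^ k` games of weight at most `k`
(`ncard_weightAtMost_le`), while for `n = 2 * m` voters ties can be broken arbitrarily, which gives
at least `2 ^ (centralBinom m / 2)` games (`two_pow_le_card`). Hence
`2 ^ n ≤ 4 * n ^ 2 * 3 ^ maxWeight n` (`two_pow_le`), and it remains to take logarithms.
-/

namespace StrongSimpleGame

/-! ### Medians, dictatorships and changes of voters -/

section General

variable {V W X : Type*} [Fintype V] [DecidableEq V] [Fintype W] [DecidableEq W]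
  [Fintype X] [DecidableEq X]

theorem mem_dictatorship {v : V} {A : Finset V} : A ∈ (dictatorship v).winning ↔ v ∈ A := by
  simp [dictatorship]

theorem mem_median {S T U : StrongSimpleGame V} {A : Finset V} :
    A ∈ (median S T U).winning ↔
      (A ∈ S.winning ∧ A ∈ T.winning) ∨ (A ∈ S.winning ∧ A ∈ U.winning) ∨
        (A ∈ T.winning ∧ A ∈ U.winning) := by
  simp only [median, Finset.mem_union, Finset.mem_inter, or_assoc]

/-- Strong simple games are maximal: an inclusion between two of them is an equality. -/
theorem eq_of_forall_mem {S T : StrongSimpleGame V}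
    (h : ∀ A ∈ T.winning, A ∈ S.winning) : S = T := by
  ext A
  refine ⟨fun hA => ?_, h A⟩
  by_contra hT
  exact S.simple A hA (h _ (T.strong A hT))

/-- Two coalitions that together comprise all voters cannot both lose. -/
theorem mem_or_mem_of_cover (S : StrongSimpleGame V) {A B : Finset V}
    (h : ∀ x, x ∈ A ∨ x ∈ B) : A ∈ S.winning ∨ B ∈ S.winning := by
  by_cases hA : A ∈ S.winning
  · exact Or.inl hA
  · refine Or.inr (S.upward _ _ (S.strong A hA) fun x hx => ?_)
    exact (h x).resolve_left (Finset.mem_compl.1 hx)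

theorem empty_notMem (S : StrongSimpleGame V) : ∅ ∉ S.winning := fun h =>
  S.simple _ h (S.upward _ _ h (Finset.empty_subset _))

instance : Finite (StrongSimpleGame V) :=
  Finite.of_injective winning fun _ _ h => StrongSimpleGame.ext h

/-- The game on `W` in which every voter `v` of the game `S` copies the vote of `f v`. -/
def map (f : V → W) (S : StrongSimpleGame V) : StrongSimpleGame W where
  winning := Finset.univ.filter fun A => Finset.univ.filter (fun v => f v ∈ A) ∈ S.winning
  upward A B hA hAB := by
    simp only [Finset.mem_filter, Finset.mem_univ, true_and] at hA ⊢
    refine S.upward _ _ hA fun v hv => ?_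
    simp only [Finset.mem_filter, Finset.mem_univ, true_and] at hv ⊢
    exact hAB hv
  simple A hA := by
    simp only [Finset.mem_filter, Finset.mem_univ, true_and] at hA ⊢
    convert S.simple _ hA using 2
    ext v; simp
  strong A hA := by
    simp only [Finset.mem_filter, Finset.mem_univ, true_and] at hA ⊢
    convert S.strong _ hA using 1
    ext v; simp

theorem mem_map {f : V → W} {S : StrongSimpleGame V} {A : Finset W} :
    A ∈ (S.map f).winning ↔ Finset.univ.filter (fun v => f v ∈ A) ∈ S.winning := by
  simp [map]

theorem map_map (f : V → W) (g : W → X) (S : StrongSimpleGame V) :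
    (S.map f).map g = S.map (g ∘ f) := by
  ext A
  simp [mem_map]

theorem map_id (S : StrongSimpleGame V) : S.map id = S := by
  ext A
  simp [mem_map]

theorem map_dictatorship (f : V → W) (v : V) : (dictatorship v).map f = dictatorship (f v) := by
  ext A
  simp [mem_map, mem_dictatorship]

theorem map_median (f : V → W) (S T U : StrongSimpleGame V) :
    (median S T U).map f = median (S.map f) (T.map f) (U.map f) := by
  ext A
  simp only [mem_map, mem_median]

theorem WeightAtMost.map (f : V → W) {k : ℕ} {S : StrongSimpleGame V} (h : WeightAtMost k S) :
    WeightAtMost k (S.map f) := by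
  induction k generalizing S with
  | zero =>
    obtain ⟨v, rfl⟩ := h
    exact ⟨f v, map_dictatorship f v⟩
  | succ k ih =>
    obtain ⟨T, U, R, hT, hU, hR, rfl⟩ := h
    exact ⟨_, _, _, ih hT, ih hU, ih hR, map_median f T U R⟩

/-! ### Merging voters -/

/-- Each game is the median of the three games in which, respectively, `a` copies `b`, `b` copies
`c`, and `c` copies `a`. Letting `x` copy `y` can turn a win of `A` into a loss only if `x ∈ A`
and `y ∉ A`, which happens for at most one of the three cyclically arranged pairs. -/
theorem eq_median_map_update (S : StrongSimpleGame V) (a b c : V) :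
    S = median (S.map (Function.update id a b)) (S.map (Function.update id b c))
      (S.map (Function.update id c a)) := by
  refine (eq_of_forall_mem fun A hA => ?_).symm
  have key : ∀ x y : V, (x ∈ A → y ∈ A) → A ∈ (S.map (Function.update id x y)).winning := by
    intro x y hxy
    refine mem_map.2 (S.upward A _ hA fun v hv => ?_)
    by_cases h : v = x
    · subst h
      simp [hxy hv]
    · simp [h, hv]
  have h1 := key a b
  have h2 := key b c
  have h3 := key c a
  rw [mem_median]
  tauto

/-- Letting `a` copy `b` gives a game on the voters other than `a`, to which `a` is added as a dummy
voter by `a.succAbove`. -/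
theorem exists_map_update_eq_map_map {n : ℕ} {a b : Fin (n + 1)} (hab : a ≠ b) :
    ∃ g : Fin (n + 1) → Fin n, g a = g b ∧ ∀ S : StrongSimpleGame (Fin (n + 1)),
      S.map (Function.update id a b) = (S.map g).map a.succAbove := by
  have h : ∀ x, ∃ y, a.succAbove y = Function.update id a b x := by
    intro x
    refine Fin.exists_succAbove_eq ?_
    by_cases hx : x = a
    · subst hx; simp [hab.symm]
    · simp [hx]
  choose g hg using h
  refine ⟨g, Fin.succAbove_right_injective (p := a) ?_, fun S => ?_⟩
  · rw [hg, hg]; simp [hab.symm]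
  · rw [map_map]
    congr 1
    exact (funext hg).symm

/-- An additional voter costs at most one more median. Merging takes three distinct voters out of
the `n + 1`, whence the bound on `n`. -/
theorem weightAtMost_succ_of_forall {n k : ℕ} (hn : 2 ≤ n)
    (h : ∀ S : StrongSimpleGame (Fin n), WeightAtMost k S)
    (S : StrongSimpleGame (Fin (n + 1))) : WeightAtMost (k + 1) S := by
  have key : ∀ a b : Fin (n + 1), a ≠ b → WeightAtMost k (S.map (Function.update id a b)) := by
    intro a b hab
    obtain ⟨g, -, hg⟩ := exists_map_update_eq_map_map hab
    rw [hg]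
    exact (h _).map _
  refine ⟨_, _, _, key ⟨0, by omega⟩ ⟨1, by omega⟩ ?_, key ⟨1, by omega⟩ ⟨2, by omega⟩ ?_,
    key ⟨2, by omega⟩ ⟨0, by omega⟩ ?_, eq_median_map_update S _ _ _⟩ <;> simp

theorem weightAtMost_of_forall_succ {n k : ℕ} (hn : 1 ≤ n)
    (h : ∀ S : StrongSimpleGame (Fin (n + 1)), WeightAtMost k S)
    (S : StrongSimpleGame (Fin n)) : WeightAtMost k S := by
  have : Nonempty (Fin n) := ⟨⟨0, hn⟩⟩
  have hS : (S.map Fin.castSucc).map (Function.invFun Fin.castSucc) = S := by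
    rw [map_map, Function.invFun_comp (Fin.castSucc_injective n), map_id]
  exact hS ▸ (h _).map _

/-! ### Games with few voters -/

theorem eq_dictatorship {S : StrongSimpleGame V} {v : V} (h : {v} ∈ S.winning) :
    S = dictatorship v :=
  eq_of_forall_mem fun _ hA =>
    S.upward _ _ h (Finset.singleton_subset_iff.2 (mem_dictatorship.1 hA))

theorem weightAtMost_zero_fin_one (S : StrongSimpleGame (Fin 1)) : WeightAtMost 0 S :=
  ⟨0, eq_dictatorship
    ((S.mem_or_mem_of_cover (A := {0}) (B := ∅) (by decide)).resolve_right S.empty_notMem)⟩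

theorem weightAtMost_zero_fin_two (S : StrongSimpleGame (Fin 2)) : WeightAtMost 0 S := by
  rcases S.mem_or_mem_of_cover (A := {0}) (B := {1}) (by decide) with h | h
  exacts [⟨0, eq_dictatorship h⟩, ⟨1, eq_dictatorship h⟩]

theorem weightAtMost_one_median_dictatorship (a b c : V) :
    WeightAtMost 1 (median (dictatorship a) (dictatorship b) (dictatorship c)) :=
  ⟨_, _, _, ⟨a, rfl⟩, ⟨b, rfl⟩, ⟨c, rfl⟩, rfl⟩

theorem weightAtMost_one_dictatorship (a : V) : WeightAtMost 1 (dictatorship a) :=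
  WeightAtMost.mono (Nat.zero_le 1) ⟨a, rfl⟩

/-- Three winning pairs share the voter `b`. Apart from the dictatorship of `b`, the possible games
are the weighted majorities with votes `b = 2`, `a = c = d = 1`, and `b = 3`, `a = c = d = e = 1`.
In this and the next two lemmas, the voters need not be distinct. -/
theorem weightAtMost_two_of_three_pairs_mem (S : StrongSimpleGame V) {a b c d e : V}
    (hV : ∀ x, x = a ∨ x = b ∨ x = c ∨ x = d ∨ x = e) (ha : {b, a} ∈ S.winning)
    (hc : {b, c} ∈ S.winning) (hd : {b, d} ∈ S.winning) : WeightAtMost 2 S := by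
  rcases S.mem_or_mem_of_cover (A := {a, c, d}) (B := {b, e})
    (by simpa [or_comm, or_left_comm, or_assoc] using hV) with h | he
  · refine ⟨_, _, _, weightAtMost_one_dictatorship b, weightAtMost_one_median_dictatorship b a c,
      weightAtMost_one_dictatorship d, eq_of_forall_mem fun A hA => ?_⟩
    have u1 := S.upward _ A h
    have u2 := S.upward _ A ha
    have u3 := S.upward _ A hc
    have u4 := S.upward _ A hd
    simp only [mem_median, mem_dictatorship, Finset.insert_subset_iff,
      Finset.singleton_subset_iff] at hA u1 u2 u3 u4
    grind
  rcases S.mem_or_mem_of_cover (A := {a, c, d, e}) (B := {b})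
    (by simpa [or_comm, or_left_comm, or_assoc] using hV) with h | h
  · refine ⟨_, _, _, weightAtMost_one_dictatorship b, weightAtMost_one_median_dictatorship b a c,
      weightAtMost_one_median_dictatorship b d e, eq_of_forall_mem fun A hA => ?_⟩
    have u1 := S.upward _ A h
    have u2 := S.upward _ A ha
    have u3 := S.upward _ A hc
    have u4 := S.upward _ A hd
    have u5 := S.upward _ A he
    simp only [mem_median, mem_dictatorship, Finset.insert_subset_iff,
      Finset.singleton_subset_iff] at hA u1 u2 u3 u4 u5
    grind
  · exact WeightAtMost.mono (Nat.zero_le 2) ⟨b, eq_dictatorship h⟩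

/-- Two winning pairs share the voter `b`. Unless there is a third one with `b`, the game is the
majority of `a`, `b`, `c`, or the weighted majority with votes `b = 3`, `a = c = 2`, `d = e = 1`. -/
theorem weightAtMost_two_of_two_pairs_mem (S : StrongSimpleGame V) {a b c d e : V}
    (hV : ∀ x, x = a ∨ x = b ∨ x = c ∨ x = d ∨ x = e) (ha : {b, a} ∈ S.winning)
    (hc : {b, c} ∈ S.winning) : WeightAtMost 2 S := by
  rcases S.mem_or_mem_of_cover (A := {a, c, d}) (B := {b, e})
    (by simpa [or_comm, or_left_comm, or_assoc] using hV) with hacd | he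
  swap
  · exact weightAtMost_two_of_three_pairs_mem S (e := d)
      (by simpa [or_comm, or_left_comm, or_assoc] using hV) ha hc he
  rcases S.mem_or_mem_of_cover (A := {a, c, e}) (B := {b, d})
    (by simpa [or_comm, or_left_comm, or_assoc] using hV) with hace | hd
  swap
  · exact weightAtMost_two_of_three_pairs_mem S hV ha hc hd
  rcases S.mem_or_mem_of_cover (A := {b, d, e}) (B := {a, c})
    (by simpa [or_comm, or_left_comm, or_assoc] using hV) with hbde | hac
  · refine ⟨_, _, _, weightAtMost_one_dictatorship b, weightAtMost_one_median_dictatorship b a c,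
      weightAtMost_one_median_dictatorship c d e, eq_of_forall_mem fun A hA => ?_⟩
    have u1 := S.upward _ A hbde
    have u2 := S.upward _ A hacd
    have u3 := S.upward _ A hace
    have u4 := S.upward _ A ha
    have u5 := S.upward _ A hc
    simp only [mem_median, mem_dictatorship, Finset.insert_subset_iff,
      Finset.singleton_subset_iff] at hA u1 u2 u3 u4 u5
    grind
  · have hS : S = median (dictatorship b) (dictatorship a) (dictatorship c) := by
      refine eq_of_forall_mem fun A hA => ?_
      have u1 := S.upward _ A ha
      have u2 := S.upward _ A hc
      have u3 := S.upward _ A hac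
      simp only [mem_median, mem_dictatorship, Finset.insert_subset_iff,
        Finset.singleton_subset_iff] at hA u1 u2 u3
      grind
    rw [hS]
    exact (weightAtMost_one_median_dictatorship b a c).mono one_le_two

/-- A game on five voters in which some pair of voters wins has weight at most two. If `{a, b}` is
the only winning pair, then `a` and `b` decide, and the majority of the other three breaks ties;
otherwise two winning pairs share a voter. -/
theorem weightAtMost_two_of_pair_mem (S : StrongSimpleGame V) {a b c d e : V}
    (hV : ∀ x, x = a ∨ x = b ∨ x = c ∨ x = d ∨ x = e) (hab : {a, b} ∈ S.winning) :
    WeightAtMost 2 S := by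
  have hba : {b, a} ∈ S.winning := Finset.pair_comm a b ▸ hab
  rcases S.mem_or_mem_of_cover (A := {a, c, d}) (B := {b, e})
    (by simpa [or_comm, or_left_comm, or_assoc] using hV) with hacd | h
  swap
  · exact weightAtMost_two_of_two_pairs_mem S (d := c) (e := d)
      (by simpa [or_comm, or_left_comm, or_assoc] using hV) hba h
  rcases S.mem_or_mem_of_cover (A := {a, c, e}) (B := {b, d})
    (by simpa [or_comm, or_left_comm, or_assoc] using hV) with hace | h
  swap
  · exact weightAtMost_two_of_two_pairs_mem S (d := c) (e := e)
      (by simpa [or_comm, or_left_comm, or_assoc] using hV) hba h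
  rcases S.mem_or_mem_of_cover (A := {a, d, e}) (B := {b, c})
    (by simpa [or_comm, or_left_comm, or_assoc] using hV) with hade | h
  swap
  · exact weightAtMost_two_of_two_pairs_mem S (d := d) (e := e)
      (by simpa [or_comm, or_left_comm, or_assoc] using hV) hba h
  rcases S.mem_or_mem_of_cover (A := {b, c, d}) (B := {a, e})
    (by simpa [or_comm, or_left_comm, or_assoc] using hV) with hbcd | h
  swap
  · exact weightAtMost_two_of_two_pairs_mem S (d := c) (e := d)
      (by simpa [or_comm, or_left_comm, or_assoc] using hV) hab h
  rcases S.mem_or_mem_of_cover (A := {b, c, e}) (B := {a, d})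
    (by simpa [or_comm, or_left_comm, or_assoc] using hV) with hbce | h
  swap
  · exact weightAtMost_two_of_two_pairs_mem S (d := c) (e := e)
      (by simpa [or_comm, or_left_comm, or_assoc] using hV) hab h
  rcases S.mem_or_mem_of_cover (A := {b, d, e}) (B := {a, c})
    (by simpa [or_comm, or_left_comm, or_assoc] using hV) with hbde | h
  swap
  · exact weightAtMost_two_of_two_pairs_mem S (d := d) (e := e)
      (by simpa [or_comm, or_left_comm, or_assoc] using hV) hab h
  refine ⟨_, _, _, weightAtMost_one_dictatorship a, weightAtMost_one_dictatorship b,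
    weightAtMost_one_median_dictatorship c d e, eq_of_forall_mem fun A hA => ?_⟩
  have u1 := S.upward _ A hab
  have u2 := S.upward _ A hacd
  have u3 := S.upward _ A hace
  have u4 := S.upward _ A hade
  have u5 := S.upward _ A hbcd
  have u6 := S.upward _ A hbce
  have u7 := S.upward _ A hbde
  simp only [mem_median, mem_dictatorship, Finset.insert_subset_iff,
    Finset.singleton_subset_iff] at hA u1 u2 u3 u4 u5 u6 u7
  grind

/-- Simple majority among five voters. -/
def majorityFive : StrongSimpleGame (Fin 5) where
  winning := Finset.univ.filter fun A => 3 ≤ A.card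
  upward A B hA hAB := by
    simp only [Finset.mem_filter, Finset.mem_univ, true_and] at hA ⊢
    exact hA.trans (Finset.card_le_card hAB)
  simple A hA := by
    simp only [Finset.mem_filter, Finset.mem_univ, true_and, Finset.card_compl,
      Fintype.card_fin] at hA ⊢
    omega
  strong A hA := by
    simp only [Finset.mem_filter, Finset.mem_univ, true_and, Finset.card_compl,
      Fintype.card_fin] at hA ⊢
    omega

theorem mem_majorityFive {A : Finset (Fin 5)} : A ∈ majorityFive.winning ↔ 3 ≤ A.card := by
  simp [majorityFive]

theorem weightAtMost_two_of_ne_majorityFive {S : StrongSimpleGame (Fin 5)}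
    (hS : S ≠ majorityFive) : WeightAtMost 2 S := by
  obtain ⟨A, hA, hA2⟩ : ∃ A ∈ S.winning, A.card ≤ 2 := by
    by_contra! h
    exact hS (eq_of_forall_mem fun A hA => mem_majorityFive.2 (h A hA)).symm
  obtain ⟨B, hAB, -, hB⟩ := Finset.exists_subsuperset_card_eq (Finset.subset_univ A) hA2 (by simp)
  obtain ⟨a, b, -, rfl⟩ := Finset.card_eq_two.1 hB
  obtain ⟨c, d, e, -, -, -, hcde⟩ :=
    Finset.card_eq_three.1 (show ({a, b}ᶜ : Finset (Fin 5)).card = 3 by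
      rw [Finset.card_compl, hB]; rfl)
  refine weightAtMost_two_of_pair_mem S (c := c) (d := d) (e := e) (fun x => ?_)
    (S.upward _ _ hA hAB)
  have hx := Finset.ext_iff.1 hcde x
  simp only [Finset.mem_compl, Finset.mem_insert, Finset.mem_singleton] at hx
  tauto

/-- Some three voters `a, b, c` form a winning coalition; merging two of them then gives a game
on five voters in which a coalition of at most two voters wins. -/
theorem weightAtMost_three_fin_six (S : StrongSimpleGame (Fin 6)) : WeightAtMost 3 S := by
  have key : ∀ a b c : Fin 6, a ≠ b → {a, b, c} ∈ S.winning →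
      WeightAtMost 2 (S.map (Function.update id a b)) := by
    intro a b c hab h
    obtain ⟨g, hg, hS⟩ := exists_map_update_eq_map_map hab
    rw [hS]
    refine (weightAtMost_two_of_ne_majorityFive fun hm => ?_).map _
    have hmem : {g b, g c} ∈ (S.map g).winning := by
      refine mem_map.2 (S.upward _ _ h fun x hx => ?_)
      simp only [Finset.mem_insert, Finset.mem_singleton] at hx
      rcases hx with rfl | rfl | rfl <;> simp [hg]
    rw [hm, mem_majorityFive] at hmem
    have := Finset.card_le_two (a := g b) (b := g c)
    omega
  obtain ⟨a, b, c, hab, hbc, hca, h⟩ :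
      ∃ a b c : Fin 6, a ≠ b ∧ b ≠ c ∧ c ≠ a ∧ {a, b, c} ∈ S.winning := by
    rcases S.mem_or_mem_of_cover (A := {0, 1, 2}) (B := {3, 4, 5}) (by decide) with h | h
    exacts [⟨0, 1, 2, by decide, by decide, by decide, h⟩,
      ⟨3, 4, 5, by decide, by decide, by decide, h⟩]
  refine ⟨_, _, _, key a b c hab h, key b c a hbc ?_, key c a b hca ?_,
    eq_median_map_update S a b c⟩ <;> convert h using 1 <;> ext x <;> simp <;> tauto

theorem exists_eq_median_dictatorship {S : StrongSimpleGame V} (h : WeightAtMost 1 S) :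
    ∃ f : Fin 3 → V,
      S = median (dictatorship (f 0)) (dictatorship (f 1)) (dictatorship (f 2)) := by
  obtain ⟨_, _, _, ⟨a, rfl⟩, ⟨b, rfl⟩, ⟨c, rfl⟩, rfl⟩ := h
  exact ⟨![a, b, c], rfl⟩

/-- A voter `v` used at most once in a median of three dictatorships is irrelevant if the other two
dictators vote for. -/
theorem mem_median_of_insert_mem {a b c v : V} {A : Finset V} (ha : a = v → b ∈ A ∧ c ∈ A)
    (hb : b = v → a ∈ A ∧ c ∈ A) (hc : c = v → a ∈ A ∧ b ∈ A)
    (h : insert v A ∈ (median (dictatorship a) (dictatorship b) (dictatorship c)).winning) :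
    A ∈ (median (dictatorship a) (dictatorship b) (dictatorship c)).winning := by
  simp only [mem_median, mem_dictatorship, Finset.mem_insert] at h ⊢
  tauto

/-- A representation of weight two involves nine dictatorships, so one of the five voters, `v`,
is used at most once, in a median of the dictatorships of `v`, `b` and `c`. The vote of `v` is then
irrelevant if both `b` and `c` vote for, though it matters in the majority game as soon as the
other four voters are tied. -/
theorem not_weightAtMost_two_majorityFive : ¬ WeightAtMost 2 majorityFive := by
  rintro ⟨T₀, T₁, T₂, h₀, h₁, h₂, h⟩
  obtain ⟨f₀, rfl⟩ := exists_eq_median_dictatorship h₀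
  obtain ⟨f₁, rfl⟩ := exists_eq_median_dictatorship h₁
  obtain ⟨f₂, rfl⟩ := exists_eq_median_dictatorship h₂
  let F : Fin 3 × Fin 3 → Fin 5 := fun p => ![f₀, f₁, f₂] p.1 p.2
  obtain ⟨v, hv⟩ := Fintype.exists_card_fiber_lt_of_card_lt_mul F (n := 2) (by simp)
  have huniq : ∀ p q, F p = v → F q = v → p = q := fun p q hp hq =>
    Finset.card_le_one.1 (Nat.lt_succ_iff.1 hv) p (by simpa using hp) q (by simpa using hq)
  -- `A` contains the siblings of the occurrence of `v`, if there is one.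
  obtain ⟨A, hA, hvA, hAF⟩ : ∃ A : Finset (Fin 5), A.card = 2 ∧ v ∉ A ∧
      ∀ i j l, F (i, j) = v → l ≠ j → F (i, l) ∈ A := by
    by_cases hex : ∃ p, F p = v
    · obtain ⟨⟨i, j⟩, hp⟩ := hex
      have hs : (Finset.univ.erase j).image (fun l => F (i, l)) ⊆ Finset.univ.erase v := by
        intro x hx
        obtain ⟨l, hl, rfl⟩ := Finset.mem_image.1 hx
        refine Finset.mem_erase.2 ⟨fun hlv => ?_, Finset.mem_univ _⟩
        have := huniq _ _ hlv hp
        simp_all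
      obtain ⟨A, hA1, hA2, hA⟩ := Finset.exists_subsuperset_card_eq (n := 2) hs
        (Finset.card_image_le.trans (by simp)) (by simp)
      refine ⟨A, hA, fun hvA => by simpa using hA2 hvA, fun i' j' l h' hl => ?_⟩
      have := huniq _ _ h' hp
      simp only [Prod.mk.injEq] at this
      obtain ⟨rfl, rfl⟩ := this
      exact hA1 (Finset.mem_image_of_mem _ (by simpa using hl))
    · obtain ⟨A, hA1, hA⟩ := Finset.exists_subset_card_eq
        (s := Finset.univ.erase v) (n := 2) (by simp)
      exact ⟨A, hA, fun hvA => by simpa using hA1 hvA, fun i j l h' => absurd ⟨_, h'⟩ hex⟩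
  have key : ∀ i, insert v A ∈ (median (dictatorship (F (i, 0))) (dictatorship (F (i, 1)))
      (dictatorship (F (i, 2)))).winning → A ∈ (median (dictatorship (F (i, 0)))
        (dictatorship (F (i, 1))) (dictatorship (F (i, 2)))).winning := fun i =>
    mem_median_of_insert_mem
      (fun h => ⟨hAF i 0 1 h (by decide), hAF i 0 2 h (by decide)⟩)
      (fun h => ⟨hAF i 1 0 h (by decide), hAF i 1 2 h (by decide)⟩)
      (fun h => ⟨hAF i 2 0 h (by decide), hAF i 2 1 h (by decide)⟩)
  have hin : insert v A ∈ majorityFive.winning := by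
    rw [mem_majorityFive, Finset.card_insert_of_notMem hvA, hA]
  have hout : A ∉ majorityFive.winning := by
    rw [mem_majorityFive, hA]; decide
  rw [h, mem_median] at hin hout
  have k0 := key 0
  have k1 := key 1
  have k2 := key 2
  rcases hin with ⟨h, h'⟩ | ⟨h, h'⟩ | ⟨h, h'⟩
  · exact hout (Or.inl ⟨k0 h, k1 h'⟩)
  · exact hout (Or.inr (Or.inl ⟨k0 h, k2 h'⟩))
  · exact hout (Or.inr (Or.inr ⟨k1 h, k2 h'⟩))

/-! ### Counting games -/

theorem ncard_weightAtMost_le (k : ℕ) :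
    {S : StrongSimpleGame V | WeightAtMost k S}.ncard ≤ Fintype.card V ^ 3 ^ k := by
  induction k with
  | zero =>
    have : {S : StrongSimpleGame V | WeightAtMost 0 S} = Set.range dictatorship := by
      ext S; simp [WeightAtMost, eq_comm]
    rw [this, ← Set.image_univ, pow_zero, pow_one, ← Nat.card_eq_fintype_card, ← Set.ncard_univ]
    exact Set.ncard_image_le
  | succ k ih =>
    set s := {S : StrongSimpleGame V | WeightAtMost k S} with hs
    have : {S : StrongSimpleGame V | WeightAtMost (k + 1) S} ⊆
        (fun p : _ × _ × _ => median p.1 p.2.1 p.2.2) '' (s ×ˢ s ×ˢ s) := by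
      rintro S ⟨T₁, T₂, T₃, h₁, h₂, h₃, rfl⟩
      exact ⟨(T₁, T₂, T₃), ⟨h₁, h₂, h₃⟩, rfl⟩
    calc _ ≤ _ := Set.ncard_le_ncard this
      _ ≤ (s ×ˢ s ×ˢ s).ncard := Set.ncard_image_le
      _ = s.ncard ^ 3 := by rw [Set.ncard_prod, Set.ncard_prod]; ring
      _ ≤ (Fintype.card V ^ 3 ^ k) ^ 3 := Nat.pow_le_pow_left ih 3
      _ = _ := by rw [← pow_mul, pow_succ]

/-- For an even number `2 * m` of voters, the game in which larger coalitions win, and ties are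
decided by the family `F` of coalitions containing the voter `v`. -/
def tieBreak {m : ℕ} (hV : Fintype.card V = 2 * m) (v : V) (F : Finset (Finset V)) :
    StrongSimpleGame V where
  winning := Finset.univ.filter fun A =>
    m < A.card ∨ (A.card = m ∧ if v ∈ A then A ∈ F else Aᶜ ∉ F)
  upward A B hA hAB := by
    simp only [Finset.mem_filter, Finset.mem_univ, true_and] at hA ⊢
    rcases hAB.eq_or_ssubset with rfl | h
    · exact hA
    · have := Finset.card_lt_card h
      omega
  simple A hA := by
    have := Finset.card_add_card_compl A
    simp only [Finset.mem_filter, Finset.mem_univ, true_and, Finset.mem_compl, compl_compl] at hA ⊢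
    grind
  strong A hA := by
    have := Finset.card_add_card_compl A
    simp only [Finset.mem_filter, Finset.mem_univ, true_and, Finset.mem_compl, compl_compl] at hA ⊢
    grind

/-- Distinct families of tying coalitions that contain `v` break ties differently. -/
theorem two_pow_le_card {m : ℕ} (hV : Fintype.card V = 2 * m) (v : V) :
    2 ^ ((Finset.powersetCard m Finset.univ).filter fun A : Finset V => v ∈ A).card ≤
      Nat.card (StrongSimpleGame V) := by
  set P := (Finset.powersetCard m Finset.univ).filter fun A : Finset V => v ∈ A with hP
  rw [← Finset.card_powerset, ← Nat.card_eq_finsetCard]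
  refine Nat.card_le_card_of_injective (fun F : P.powerset => tieBreak hV v F) ?_
  rintro ⟨F, hF⟩ ⟨G, hG⟩ h
  rw [Finset.mem_powerset] at hF hG
  have key : ∀ A ∈ P, (A ∈ F ↔ A ∈ G) := by
    intro A hA
    have hA' := Finset.ext_iff.1 (congrArg winning h) A
    simp only [hP, Finset.mem_filter, Finset.mem_powersetCard] at hA
    simpa [tieBreak, hA.1.2, hA.2] using hA'
  refine Subtype.ext (Finset.ext fun A => ⟨fun hA => ?_, fun hA => ?_⟩)
  · exact (key A (hF hA)).1 hA
  · exact (key A (hG hA)).2 hA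

/-- Complementation exchanges the tying coalitions with and without `v`. -/
theorem two_mul_card_filter_mem {m : ℕ} (hV : Fintype.card V = 2 * m) (v : V) :
    2 * ((Finset.powersetCard m Finset.univ).filter fun A : Finset V => v ∈ A).card =
      m.centralBinom := by
  have h : ((Finset.powersetCard m Finset.univ).filter fun A : Finset V => v ∈ A).card =
      ((Finset.powersetCard m Finset.univ).filter fun A : Finset V => v ∉ A).card := by
    refine Finset.card_bij' (fun A _ => Aᶜ) (fun A _ => Aᶜ) ?_ ?_ (by simp) (by simp)
    all_goals
      intro A
      have := Finset.card_add_card_compl A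
      simp only [Finset.mem_filter, Finset.mem_powersetCard, Finset.subset_univ, true_and,
        Finset.mem_compl, not_not]
      grind
  have h2 := Finset.card_filter_add_card_filter_not (s := Finset.powersetCard m Finset.univ)
    (fun A : Finset V => v ∈ A)
  rw [Finset.card_powersetCard, Finset.card_univ, hV, ← Nat.centralBinom_eq_two_mul_choose] at h2
  omega

end General

/-! ### The maximal weight -/

theorem exists_forall_weightAtMost {n : ℕ} (hn : 1 ≤ n) :
    ∃ k, ∀ S : StrongSimpleGame (Fin n), WeightAtMost k S := by
  induction n, hn using Nat.le_induction with
  | base => exact ⟨0, weightAtMost_zero_fin_one⟩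
  | succ n hn ih =>
    obtain rfl | hn := hn.eq_or_lt
    · exact ⟨0, weightAtMost_zero_fin_two⟩
    · obtain ⟨k, hk⟩ := ih
      exact ⟨k + 1, weightAtMost_succ_of_forall hn hk⟩

theorem weightAtMost_weight {n : ℕ} (hn : 1 ≤ n) (S : StrongSimpleGame (Fin n)) :
    WeightAtMost S.weight S :=
  Nat.sInf_mem (s := {k | WeightAtMost k S}) ((exists_forall_weightAtMost hn).imp fun _ h => h S)

theorem isGreatest_maxWeight {n : ℕ} (hn : 1 ≤ n) :
    IsGreatest (Set.range (weight : StrongSimpleGame (Fin n) → ℕ)) (maxWeight n) := by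
  have hb := (Set.finite_range (weight : StrongSimpleGame (Fin n) → ℕ)).bddAbove
  exact ⟨Nat.sSup_mem ⟨_, dictatorship ⟨0, hn⟩, rfl⟩ hb, fun _ h => le_csSup hb h⟩

theorem maxWeight_le_iff {n k : ℕ} (hn : 1 ≤ n) :
    maxWeight n ≤ k ↔ ∀ S : StrongSimpleGame (Fin n), WeightAtMost k S := by
  rw [isLUB_le_iff (isGreatest_maxWeight hn).isLUB, mem_upperBounds, Set.forall_mem_range]
  exact forall_congr' fun S => ⟨fun h => (weightAtMost_weight hn S).mono h, fun h => Nat.sInf_le h⟩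

theorem maxWeight_succ_le {n : ℕ} (hn : 2 ≤ n) : maxWeight (n + 1) ≤ maxWeight n + 1 :=
  (maxWeight_le_iff (by omega)).2
    (weightAtMost_succ_of_forall hn ((maxWeight_le_iff (by omega)).1 le_rfl))

theorem maxWeight_le_succ {n : ℕ} (hn : 1 ≤ n) : maxWeight n ≤ maxWeight (n + 1) :=
  (maxWeight_le_iff hn).2
    (weightAtMost_of_forall_succ hn ((maxWeight_le_iff (by omega)).1 le_rfl))

theorem maxWeight_one : maxWeight 1 = 0 :=
  Nat.le_zero.1 ((maxWeight_le_iff le_rfl).2 weightAtMost_zero_fin_one)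

theorem maxWeight_two : maxWeight 2 = 0 :=
  Nat.le_zero.1 ((maxWeight_le_iff (by omega)).2 weightAtMost_zero_fin_two)

theorem three_le_maxWeight_five : 3 ≤ maxWeight 5 := by
  by_contra! h
  exact not_weightAtMost_two_majorityFive
    ((maxWeight_le_iff (by omega)).1 (Nat.lt_succ_iff.1 h) majorityFive)

theorem maxWeight_six_le : maxWeight 6 ≤ 3 :=
  (maxWeight_le_iff (by omega)).2 weightAtMost_three_fin_six

theorem maxWeight_le_sub_three {n : ℕ} (hn : 6 ≤ n) : maxWeight n ≤ n - 3 := by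
  induction n, hn using Nat.le_induction with
  | base => exact maxWeight_six_le
  | succ n hn ih =>
    have := maxWeight_succ_le (n := n) (by omega)
    omega

/-- The count of games, with `2 * m ≤ 2 ^ (2 * m)` used to write both bounds as powers of two. -/
theorem four_pow_le {m : ℕ} (hm : 1 ≤ m) :
    4 ^ m ≤ 8 * m ^ 2 * 3 ^ maxWeight (2 * m) := by
  set w := maxWeight (2 * m) with hw
  have hV : Fintype.card (Fin (2 * m)) = 2 * m := by simp
  let v : Fin (2 * m) := ⟨0, by omega⟩
  have h1 := two_pow_le_card hV v
  have h2 := two_mul_card_filter_mem hV v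
  set N := ((Finset.powersetCard m Finset.univ).filter fun A : Finset (Fin (2 * m)) => v ∈ A).card
  have h3 : Nat.card (StrongSimpleGame (Fin (2 * m))) ≤ (2 * m) ^ 3 ^ w := by
    have h := ncard_weightAtMost_le (V := Fin (2 * m)) w
    have huniv : {S : StrongSimpleGame (Fin (2 * m)) | WeightAtMost w S} = Set.univ :=
      Set.eq_univ_of_forall ((maxWeight_le_iff (by omega)).1 le_rfl)
    rwa [huniv, Set.ncard_univ, hV] at h
  have h4 : N ≤ 2 * m * 3 ^ w := by
    rw [← Nat.pow_le_pow_iff_right (a := 2) (by norm_num), pow_mul]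
    exact h1.trans (h3.trans (Nat.pow_le_pow_left Nat.lt_two_pow_self.le _))
  calc 4 ^ m ≤ 2 * m * m.centralBinom := Nat.four_pow_le_two_mul_self_mul_centralBinom m hm
    _ = 4 * m * N := by rw [← h2]; ring
    _ ≤ 4 * m * (2 * m * 3 ^ w) := Nat.mul_le_mul_left _ h4
    _ = _ := by ring

/-- For odd `n` this is reduced to `n - 1` voters, at the cost of a factor of two. -/
theorem two_pow_le {n : ℕ} (hn : 2 ≤ n) : 2 ^ n ≤ 4 * n ^ 2 * 3 ^ maxWeight n := by
  obtain ⟨m, rfl | rfl⟩ := n.even_or_odd'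
  · have h := four_pow_le (m := m) (by omega)
    rw [pow_mul]
    exact h.trans (Nat.mul_le_mul_right _ (by nlinarith))
  · have h := four_pow_le (m := m) (by omega)
    have hmono : 3 ^ maxWeight (2 * m) ≤ 3 ^ maxWeight (2 * m + 1) :=
      Nat.pow_le_pow_right (by norm_num) (maxWeight_le_succ (by omega))
    calc 2 ^ (2 * m + 1) = 2 * 4 ^ m := by rw [pow_succ, pow_mul]; norm_num; ring
      _ ≤ 2 * (8 * m ^ 2 * 3 ^ maxWeight (2 * m)) := Nat.mul_le_mul_left _ h
      _ ≤ 2 * (8 * m ^ 2 * 3 ^ maxWeight (2 * m + 1)) := by gcongr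
      _ = 4 * (2 * m) ^ 2 * 3 ^ maxWeight (2 * m + 1) := by ring
      _ ≤ _ := by gcongr; omega

theorem sub_log_le_maxWeight {n : ℕ} (hn : 2 ≤ n) :
    Real.log 2 / Real.log 3 * (n : ℝ) - 4 / Real.log 3 * Real.log n ≤ (maxWeight n : ℝ) := by
  have h3 : 0 < Real.log 3 := Real.log_pos (by norm_num)
  have hn0 : (n : ℝ) ≠ 0 := by positivity
  have h : ((2 : ℝ)) ^ n ≤ 2 ^ 2 * (n : ℝ) ^ 2 * 3 ^ maxWeight n := by
    have := two_pow_le hn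
    norm_num
    exact_mod_cast this
  have hl := Real.log_le_log (by positivity) h
  rw [Real.log_mul (by positivity) (by positivity), Real.log_mul (by positivity) (by positivity),
    Real.log_pow, Real.log_pow, Real.log_pow, Real.log_pow] at hl
  have h2n : Real.log 2 ≤ Real.log n := Real.log_le_log (by norm_num) (by exact_mod_cast hn)
  rw [div_mul_eq_mul_div, div_mul_eq_mul_div, ← sub_div, div_le_iff₀ h3]
  push_cast at hl
  linarith

theorem eventually_mul_le_maxWeight {c : ℝ} (hc : c < Real.log 2 / Real.log 3) :
    ∀ᶠ n : ℕ in Filter.atTop, c * (n : ℝ) ≤ (maxWeight n : ℝ) := by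
  have h3 : 0 < Real.log 3 := Real.log_pos (by norm_num)
  have hlog := (Real.isLittleO_log_id_atTop.comp_tendsto tendsto_natCast_atTop_atTop).bound
    (show 0 < (Real.log 2 / Real.log 3 - c) * (Real.log 3 / 4) from
      mul_pos (sub_pos.2 hc) (by positivity))
  filter_upwards [hlog, Filter.eventually_ge_atTop 2] with n hn h2
  have hle := sub_log_le_maxWeight h2
  simp only [Function.comp_apply, id, Real.norm_eq_abs, Nat.abs_cast] at hn
  have h4 : 4 / Real.log 3 * Real.log n ≤ (Real.log 2 / Real.log 3 - c) * n := by
    calc 4 / Real.log 3 * Real.log n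
        ≤ 4 / Real.log 3 * ((Real.log 2 / Real.log 3 - c) * (Real.log 3 / 4) * n) :=
          mul_le_mul_of_nonneg_left ((le_abs_self _).trans hn) (by positivity)
      _ = _ := by field_simp
  linarith

end StrongSimpleGame

open StrongSimpleGame in
theorem mainTheorem7 :
    -- the weight and its maximum are well defined
    (∀ n : ℕ, 1 ≤ n →
      (∀ S : StrongSimpleGame (Fin n), ∃ k : ℕ, S.WeightAtMost k) ∧
      IsGreatest (Set.range (StrongSimpleGame.weight : StrongSimpleGame (Fin n) → ℕ))
        (maxWeight n)) ∧
    -- (1)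
    (maxWeight 1 = 0 ∧ maxWeight 2 = 0 ∧ maxWeight 3 = 1 ∧
      maxWeight 4 = 2 ∧ maxWeight 5 = 3 ∧ maxWeight 6 = 3) ∧
    -- (2)
    (∀ n : ℕ, 6 ≤ n → maxWeight n ≤ n - 3) ∧
    -- (3)
    ((∀ c : ℝ, c < Real.log 2 / Real.log 3 →
        ∀ᶠ n : ℕ in Filter.atTop, c * (n : ℝ) ≤ (maxWeight n : ℝ)) ∧
      (∃ C : ℝ, ∀ n : ℕ, 2 ≤ n →
        Real.log 2 / Real.log 3 * (n : ℝ) - C * Real.log (n : ℝ) ≤ (maxWeight n : ℝ))) ∧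
    -- (4)
    (∀ n : ℕ, 1 ≤ n →
      maxWeight (n + 1) = maxWeight n ∨ maxWeight (n + 1) = maxWeight n + 1) := by
  refine ⟨fun n hn => ⟨fun S => ⟨_, weightAtMost_weight hn S⟩, isGreatest_maxWeight hn⟩, ?_,
    fun n hn => maxWeight_le_sub_three hn,
    ⟨fun c hc => eventually_mul_le_maxWeight hc, _, fun n hn => sub_log_le_maxWeight hn⟩,
    fun n hn => ?_⟩
  · have h1 := maxWeight_one
    have h2 := maxWeight_two
    have h3 : maxWeight 3 ≤ maxWeight 2 + 1 := maxWeight_succ_le (by omega)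
    have h4 : maxWeight 4 ≤ maxWeight 3 + 1 := maxWeight_succ_le (by omega)
    have h5 : maxWeight 5 ≤ maxWeight 4 + 1 := maxWeight_succ_le (by omega)
    have h5' := three_le_maxWeight_five
    have h6 : maxWeight 5 ≤ maxWeight 6 := maxWeight_le_succ (by omega)
    have h6' := maxWeight_six_le
    omega
  · have hle := maxWeight_le_succ hn
    obtain rfl | hn := hn.eq_or_lt
    · left; rw [maxWeight_one, maxWeight_two]
    · have := maxWeight_succ_le (n := n) hn
      omega
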